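/- **Setting.** An sc-LTL formula over a set $P$ of propositions is built from $\top$, $\pi$, $\neg\pi$ ($\pi\in P$) with $\wedge,\vee,\bigcirc,\mathcal U$. A finite word over $2^P$ satisfies it if every infinite continuation does. A DFA of the formula is a deterministic finite automaton $(Q,q^0,\delta,F)$ accepting exactly the finite words that satisfy it, where $\delta(q,q')$ is the propositional formula on the edge from $q$ to $q'$. A hierarchical sc-LTL specification $\Phi$ over atomic propositions $AP$ has $K\ge 1$ levels of sc-LTL formulas, with exactly one formula $\phi_1^1$ at the highest level. The propositions of each formula are either all in $AP$ (a leaf specification) or all formulas of the next lower level. Each formula below the highest level occurs in exactly one formula. There are $n$ robots, and robot $r$ has configuration states $S_r$ with labels $L_r:S_r\to 2^{AP}$. Joint states $s=(s_1,\dots,s_n)$ form a transition system with an initial state and an arbitrary transition relation; for instance, the states may be convex sets in configuration space. A state-specification sequence $\tau=\tau_0\cdots\tau_h$ gives, at each time, for each robot $r$ a pair $(s_r,\psi_r)$, where $\psi_r$ is a leaf specification or the null specification $\epsilon$. Satisfaction of $\phi\in\Phi$ by $\tau$ (or by a prefix of $\tau$, possibly empty) is defined from the lowest level upwards. A leaf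 $\phi$ is evaluated on the word whose $i$-th letter is the union of $L_r(s_r)$ over the robots with $\psi_r=\phi$ at time $i$. A non-leaf $\phi$ is evaluated on the word whose $i$-th letter is the set of those formulas occurring in $\phi$ that $\tau_0\cdots\tau_i$ satisfies. The sequence $\tau$ satisfies $\Phi$ if it satisfies $\phi_1^1$. Fix a DFA for each formula of $\Phi$. The product automaton has states $(s,(q_\phi)_{\phi\in\Phi})$, and its initial state consists of the initial states of all components. It has a transition from $(s,q)$ to $(s',q')$ if the following hold. 1. The transition system has a transition $s\to s'$. 2. There is an assignment of each robot to a leaf specification or to $\epsilon$ such that, for every leaf $\phi$: (a) some $\sigma\supseteq\bigcup_r L_r(s_r)$ satisfies $\delta_\phi(q_\phi,q'_\phi)$, that is, the robots' labels do not falsify this formula; (b) if some robots are assigned to $\phi$, the union of their labels satisfies $\delta_\phi(q_\phi,q'_\phi)$; (c) if no robot is assigned to $\phi$, the empty label satisfies $\delta_\phi(q_\phi,q'_\phi)$. 3. For every non-leaf $\phi$, the set of those formulas $\phi'$ occurring in $\phi$ with $q'_{\phi'}\in F_{\phi'}$ satisfies $\delta_\phi(q_\phi,q'_\phi)$. A state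 is accepting if its component $q_{\phi_1^1}$ is in $F_{\phi_1^1}$. The planner returns a finite path from the initial state to an accepting state. **Theorem (Soundness).** Every path $p=(s^0,q^0)\cdots(s^h,q^h)$ of the product automaton from the initial state to an accepting state satisfies $\Phi$. More precisely, there is a state-specification sequence $\tau=\tau_0\cdots\tau_h$ with configuration states $s^0,\dots,s^h$ such that: * for every $t<h$, the robot assignment in $\tau_t$ fulfils (a)–(c) for the transition from $(s^t,q^t)$ to $(s^{t+1},q^{t+1})$; * for every $t\le h$ and every leaf or non-leaf $\phi\in\Phi$, $q^t_\phi\in F_\phi$ if and only if the prefix $\tau_0\cdots\tau_{t-1}$ satisfies $\phi$; * $\tau$ satisfies $\phi_1^1$, and hence $\Phi$. -/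

import Mathlib

namespace HierLTL

/-! ### Syntactically co-safe LTL and good prefixes -/

/-- Syntactically co-safe LTL formulas in positive normal form over the propositions `P`:
negation only in front of propositions, temporal operators "next" and "until"
("eventually `φ`" is `until tru φ`). -/
inductive ScLTL (P : Type*) where
  | tru : ScLTL P
  | atom : P → ScLTL P
  | natom : P → ScLTL P
  | and : ScLTL P → ScLTL P → ScLTL P
  | or : ScLTL P → ScLTL P → ScLTL P
  | next : ScLTL P → ScLTL P
  | until : ScLTL P → ScLTL P → ScLTL P

/-- `φ.SatAt σ i`: the infinite word `σ` over `2^P` satisfies `φ` at position `i`. -/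
def ScLTL.SatAt {P : Type*} : ScLTL P → (ℕ → Set P) → ℕ → Prop
  | .tru, _, _ => True
  | .atom p, σ, i => p ∈ σ i
  | .natom p, σ, i => p ∉ σ i
  | .and φ ψ, σ, i => φ.SatAt σ i ∧ ψ.SatAt σ i
  | .or φ ψ, σ, i => φ.SatAt σ i ∨ ψ.SatAt σ i
  | .next φ, σ, i => φ.SatAt σ (i + 1)
  | .until φ ψ, σ, i => ∃ k, i ≤ k ∧ ψ.SatAt σ k ∧ ∀ j, i ≤ j → j < k → φ.SatAt σ j

/-- The set `Prop(φ)` of propositions that occur in `φ`. -/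
def ScLTL.props {P : Type*} : ScLTL P → Set P
  | .tru => ∅
  | .atom p => {p}
  | .natom p => {p}
  | .and φ ψ => φ.props ∪ ψ.props
  | .or φ ψ => φ.props ∪ ψ.props
  | .next φ => φ.props
  | .until φ ψ => φ.props ∪ ψ.props

/-- A finite word satisfies a co-safe formula if it is a good prefix: every infinite
continuation of it satisfies the formula. -/
def ScLTL.GoodPrefix {P : Type*} (φ : ScLTL P) (w : List (Set P)) : Prop :=
  ∀ σ : ℕ → Set P, (∀ (i : ℕ) (h : i < w.length), σ i = w[i]) → φ.SatAt σ 0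

/-! ### Deterministic finite automata with propositional formulas on the edges -/

/-- Propositional formulas over `P`. -/
inductive PropFormula (P : Type*) where
  | tru : PropFormula P
  | fls : PropFormula P
  | atom : P → PropFormula P
  | neg : PropFormula P → PropFormula P
  | and : PropFormula P → PropFormula P → PropFormula P
  | or : PropFormula P → PropFormula P → PropFormula P

/-- `γ.Sat σ`: the label `σ ∈ 2^P` satisfies the propositional formula `γ`. -/
def PropFormula.Sat {P : Type*} : PropFormula P → Set P → Prop
  | .tru, _ => True
  | .fls, _ => False
  | .atom p, σ => p ∈ σ
  | .neg γ, σ => ¬ γ.Sat σ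
  | .and γ η, σ => γ.Sat σ ∧ η.Sat σ
  | .or γ η, σ => γ.Sat σ ∨ η.Sat σ

/-- A deterministic finite automaton over the alphabet `2^P`. `guard q q'` is the propositional
formula `δ(q, q')` on the edge from `q` to `q'` (`fls` where there is no edge); a label enables
at most one edge out of each state. -/
structure SymbolicDFA (P : Type*) where
  State : Type
  finite : Finite State
  start : State
  accept : Set State
  guard : State → State → PropFormula P
  deterministic : ∀ (q : State) (σ : Set P) (q₁ q₂ : State),
    (guard q q₁).Sat σ → (guard q q₂).Sat σ → q₁ = q₂

/-- `A.Reads q w q'`: reading `w` can lead from `q` to `q'`. -/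
def SymbolicDFA.Reads {P : Type*} (A : SymbolicDFA P) : A.State → List (Set P) → A.State → Prop
  | q, [], q' => q = q'
  | q, σ :: w, q' => ∃ q₁, (A.guard q q₁).Sat σ ∧ A.Reads q₁ w q'

/-- `A` is a DFA of the co-safe formula `φ`: it accepts exactly the good prefixes of `φ`. -/
def SymbolicDFA.Recognizes {P : Type*} (A : SymbolicDFA P) (φ : ScLTL P) : Prop :=
  ∀ w : List (Set P), (∃ q ∈ A.accept, A.Reads A.start w q) ↔ φ.GoodPrefix w

/-! ### Hierarchical sc-LTL specifications -/

/-- A hierarchical sc-LTL specification with `K ≥ 1` levels (level `0` is the highest); the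
`i`-th formula of level `k` is indexed by `⟨k, i⟩`. Its propositions are `Sum.inl a`, the atomic
proposition `a`, or `Sum.inr w`, the composite proposition that stands for the formula with
index `w`. There is one formula at the highest level; each formula consists entirely of atomic
propositions or entirely of formulas of the next lower level; each formula that is not at the
highest level occurs in exactly one formula. -/
structure HierSpec (AP : Type*) where
  K : ℕ
  K_pos : 0 < K
  width : Fin K → ℕ
  formula : (Σ k : Fin K, Fin (width k)) → ScLTL (AP ⊕ (Σ k : Fin K, Fin (width k)))
  width_top : width ⟨0, K_pos⟩ = 1
  homogeneous : ∀ v, (∀ x ∈ (formula v).props, ∃ a, x = Sum.inl a) ∨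
    (∀ x ∈ (formula v).props, ∃ w, x = Sum.inr w ∧ (w.1 : ℕ) = (v.1 : ℕ) + 1)
  unique_parent : ∀ w : (Σ k : Fin K, Fin (width k)), (w.1 : ℕ) ≠ 0 →
    ∃! v, Sum.inr w ∈ (formula v).props

namespace HierSpec

variable {AP : Type*} (Φ : HierSpec AP)

/-- Indices of the formulas of `Φ`. -/
abbrev Spec : Type := Σ k : Fin Φ.K, Fin (Φ.width k)

/-- Atomic propositions and composite propositions. -/
abbrev Atom := AP ⊕ Φ.Spec

/-- The unique formula at the highest level. -/
def top : Φ.Spec := ⟨⟨0, Φ.K_pos⟩, ⟨0, by rw [Φ.width_top]; exact Nat.one_pos⟩⟩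

/-- A leaf specification consists entirely of atomic propositions. -/
def IsLeaf (v : Φ.Spec) : Prop := ∀ x ∈ (Φ.formula v).props, ∃ a, x = Sum.inl a

/-- The leaf specifications. -/
abbrev Leaf : Type := {v : Φ.Spec // Φ.IsLeaf v}

/-- The specifications that occur in the formula `v`. -/
def children (v : Φ.Spec) : Set Φ.Spec := {w | Sum.inr w ∈ (Φ.formula v).props}

theorem level_of_mem_children {v w : Φ.Spec} (h : w ∈ Φ.children v) :
    (w.1 : ℕ) = (v.1 : ℕ) + 1 := by
  rcases Φ.homogeneous v with h' | h'
  · obtain ⟨a, ha⟩ := h' _ h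
    cases ha
  · obtain ⟨u, hu, hl⟩ := h' _ h
    cases hu
    exact hl

end HierSpec

/-! ### The robots -/

/-- The product transition system of `n` robots: robot `r` has the configuration states `S r`
(for instance convex sets of its configuration space) and the labelling `label r`; `step` is the
transition relation on joint states. -/
structure ProductTS (AP : Type*) {n : ℕ} (S : Fin n → Type*) where
  init : ∀ r, S r
  step : (∀ r, S r) → (∀ r, S r) → Prop
  label : ∀ r, S r → Set AP

/-! ### State-specification sequences and the semantics of hierarchical sc-LTL -/

/-- A state-specification sequence: at each time each robot is paired with the leaf
specification it is undertaking, or with the null specification `none`. -/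
abbrev StateSpecSeq {AP : Type*} (Φ : HierSpec AP) {n : ℕ} (S : Fin n → Type*) :=
  List (∀ r : Fin n, S r × Option Φ.Leaf)

/-- `Holds T Φ v τ`: the sequence `τ` satisfies the specification `v` of `Φ`. The word on which
`v` is evaluated has, at time `i`, the labels of the robots that undertake `v` at that time (if
`v` is a leaf), and the formulas occurring in `v` that the sequence up to and including time `i`
satisfies (if `v` is not a leaf). -/
def Holds {AP : Type*} {n : ℕ} {S : Fin n → Type*} (T : ProductTS AP S) (Φ : HierSpec AP)
    (v : Φ.Spec) (τ : StateSpecSeq Φ S) : Prop :=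
  (Φ.formula v).GoodPrefix <| List.ofFn fun i : Fin τ.length =>
    Sum.inl '' {a : AP | ∃ r : Fin n, (τ[i] r).2.map Subtype.val = some v ∧
      a ∈ T.label r (τ[i] r).1} ∪
    Sum.inr '' {w : Φ.Spec | ∃ _ : w ∈ Φ.children v, Holds T Φ w (τ.take ((i : ℕ) + 1))}
termination_by Φ.K - (v.1 : ℕ)
decreasing_by
  have h := Φ.level_of_mem_children ‹w ∈ Φ.children v›
  have := w.1.isLt
  omega

/-- A state-specification sequence satisfies `Φ` if it satisfies the formula at the highest
level. -/
def StateSpecSeq.Satisfies {AP : Type*} {n : ℕ} {S : Fin n → Type*} {Φ : HierSpec AP}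
    (τ : StateSpecSeq Φ S) (T : ProductTS AP S) : Prop :=
  Holds T Φ Φ.top τ

/-! ### Models, the total product of the DFAs, and the product automaton -/

/-- The union of the labels of the robots in `R`, as a label over `Φ.Atom`. -/
def unionLabel {AP : Type*} (Φ : HierSpec AP) {n : ℕ} (L : Fin n → Set AP) (R : Set (Fin n)) :
    Set Φ.Atom :=
  Sum.inl '' (⋃ r ∈ R, L r)

/-- The assignment `m` of robots to leaf specifications (`none`: idle) shows that the robot
labels `L` are a model of the propositional formulas `γ`, one for each leaf specification. It
splits the robots into the idle ones and pairwise disjoint groups, one for each leaf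
specification that is worked on. -/
structure IsAllocation {AP : Type*} (Φ : HierSpec AP) {n : ℕ} (L : Fin n → Set AP)
    (γ : Φ.Leaf → PropFormula Φ.Atom) (m : Fin n → Option Φ.Leaf) : Prop where
  /-- No formula is falsified by the propositions that the robots make true: these can be
  completed to a label satisfying it. -/
  not_falsified : ∀ v, ∃ σ, unionLabel Φ L Set.univ ⊆ σ ∧ (γ v).Sat σ
  /-- A group of working robots satisfies its formula. -/
  working : ∀ v, {r | m r = some v}.Nonempty → (γ v).Sat (unionLabel Φ L {r | m r = some v})
  /-- The formula of a leaf specification without robots is satisfied by the empty label. -/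
  idle_task : ∀ v, {r | m r = some v} = ∅ → (γ v).Sat ∅

/-- The robot labels `L` are a model of the propositional formulas `γ`. -/
def IsModel {AP : Type*} (Φ : HierSpec AP) {n : ℕ} (L : Fin n → Set AP)
    (γ : Φ.Leaf → PropFormula Φ.Atom) : Prop :=
  ∃ m : Fin n → Option Φ.Leaf, IsAllocation Φ L γ m

/-- States of the total product of the DFAs of all specifications. -/
abbrev TotalState {AP : Type*} (Φ : HierSpec AP) (A : Φ.Spec → SymbolicDFA Φ.Atom) :=
  ∀ v : Φ.Spec, (A v).State

/-- The transition relation of the total product of the DFAs under the robot labels `L`: the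
labels are a model of the edge formulas of the leaf specifications, and the edge formula of a
non-leaf specification is satisfied by the set of those formulas occurring in it whose DFAs are
in accepting states after the transition. -/
def TotalStep {AP : Type*} (Φ : HierSpec AP) (A : Φ.Spec → SymbolicDFA Φ.Atom) {n : ℕ}
    (L : Fin n → Set AP) (q q' : TotalState Φ A) : Prop :=
  IsModel Φ L (fun v => (A v.1).guard (q v.1) (q' v.1)) ∧
  ∀ v : Φ.Spec, ¬ Φ.IsLeaf v →
    ((A v).guard (q v) (q' v)).Sat (Sum.inr '' {w ∈ Φ.children v | q' w ∈ (A w).accept})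

/-- A state of the product automaton. -/
structure ProdState {AP : Type*} (Φ : HierSpec AP) (A : Φ.Spec → SymbolicDFA Φ.Atom) {n : ℕ}
    (S : Fin n → Type*) where
  conf : ∀ r, S r
  dfa : TotalState Φ A

/-- The transition relation of the product automaton. -/
def ProdStep {AP : Type*} {Φ : HierSpec AP} {A : Φ.Spec → SymbolicDFA Φ.Atom} {n : ℕ}
    {S : Fin n → Type*} (T : ProductTS AP S) (x y : ProdState Φ A S) : Prop :=
  T.step x.conf y.conf ∧ TotalStep Φ A (fun r => T.label r (x.conf r)) x.dfa y.dfa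

/-- A path that the planner may return: it runs in the product automaton from the initial state
to an accepting state, that is, a state where the DFA of the highest formula accepts. -/
structure IsAcceptingPath {AP : Type*} {Φ : HierSpec AP} {A : Φ.Spec → SymbolicDFA Φ.Atom}
    {n : ℕ} {S : Fin n → Type*} (T : ProductTS AP S) (p : List (ProdState Φ A S)) : Prop where
  nonempty : p ≠ []
  initial : p.head nonempty = ⟨T.init, fun v => (A v).start⟩
  steps : ∀ (t : ℕ) (h : t + 1 < p.length), ProdStep T p[t] p[t + 1]
  accepting : (p.getLast nonempty).dfa Φ.top ∈ (A Φ.top).accept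

end HierLTL

namespace HierLTL

/-! Fix for each transition of the path an assignment of robots witnessing it, and pair it with the
configuration states to form `τ`. Then the DFA component of every specification along the path is a
run on exactly the word on which that specification is evaluated. For a leaf this is what the
allocation conditions say (`IsAllocation.sat_unionLabel`). For a non-leaf, the edge reads the
children whose DFAs accept after the transition; by induction from the lowest level upwards, these
are the children satisfied by the prefix read so far. Determinism makes the run unique, so its end
state accepts iff the word is a good prefix (`mem_accept_iff_holds`). A path with `h` transitions
fixes only `h` letters, while `τ` has `h + 1`; the extra letter is harmless because satisfaction
survives extension (`Holds.of_take`). -/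

theorem ScLTL.GoodPrefix.of_prefix {P : Type*} {φ : ScLTL P} {w w' : List (Set P)}
    (h : φ.GoodPrefix w) (hw : w <+: w') : φ.GoodPrefix w' := by
  intro σ hσ
  refine h σ fun i hi => ?_
  rw [hσ i (hi.trans_le hw.length_le), hw.getElem hi]

namespace SymbolicDFA

variable {P : Type*} (A : SymbolicDFA P)

theorem Reads.unique {A : SymbolicDFA P} {w : List (Set P)} {q q₁ q₂ : A.State}
    (h₁ : A.Reads q w q₁) (h₂ : A.Reads q w q₂) : q₁ = q₂ := by
  induction w generalizing q with
  | nil => exact Eq.trans (Eq.symm h₁) h₂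
  | cons σ w ih =>
    obtain ⟨a, ha, h₁⟩ := h₁
    obtain ⟨b, hb, h₂⟩ := h₂
    obtain rfl := A.deterministic q σ a b ha hb
    exact ih h₁ h₂

theorem reads_of_guard_sat (w : List (Set P)) (q : ℕ → A.State)
    (h : ∀ (i : ℕ) (hi : i < w.length), (A.guard (q i) (q (i + 1))).Sat w[i]) :
    A.Reads (q 0) w (q w.length) := by
  induction w generalizing q with
  | nil => rfl
  | cons σ w ih =>
    refine ⟨q 1, h 0 (Nat.succ_pos _), ih (fun i => q (i + 1)) fun i hi => ?_⟩
    exact h (i + 1) (Nat.succ_lt_succ hi)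

/-- Acceptance only asks for some accepting run; since runs are unique, any given run on the word
decides it. -/
theorem Recognizes.mem_accept_iff {A : SymbolicDFA P} {φ : ScLTL P} (hA : A.Recognizes φ)
    {w : List (Set P)} {q : A.State} (h : A.Reads A.start w q) :
    q ∈ A.accept ↔ φ.GoodPrefix w := by
  rw [← hA w]
  refine ⟨fun hq => ⟨q, hq, h⟩, ?_⟩
  rintro ⟨q', hq', h'⟩
  exact h.unique h' ▸ hq'

end SymbolicDFA

theorem HierSpec.children_eq_empty {AP : Type*} (Φ : HierSpec AP) {v : Φ.Spec}
    (hv : Φ.IsLeaf v) : Φ.children v = ∅ := by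
  refine Set.eq_empty_of_forall_notMem fun w hw => ?_
  obtain ⟨a, ha⟩ := hv _ hw
  cases ha

variable {AP : Type*} {n : ℕ} {S : Fin n → Type*}

/-- The letter read by the specification `v` at a time when the robots have the
state-specification pairs `x` and the specifications in `H` are satisfied. -/
def letter (T : ProductTS AP S) (Φ : HierSpec AP) (v : Φ.Spec)
    (x : ∀ r : Fin n, S r × Option Φ.Leaf) (H : Set Φ.Spec) : Set Φ.Atom :=
  Sum.inl '' {a : AP | ∃ r : Fin n, (x r).2.map Subtype.val = some v ∧ a ∈ T.label r (x r).1} ∪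
    Sum.inr '' {w ∈ Φ.children v | w ∈ H}

theorem letter_leaf (T : ProductTS AP S) (Φ : HierSpec AP) (v : Φ.Leaf)
    (x : ∀ r : Fin n, S r × Option Φ.Leaf) (H : Set Φ.Spec) :
    letter T Φ v.1 x H =
      unionLabel Φ (fun r => T.label r (x r).1) {r | (x r).2 = some v} := by
  have h : ∀ r, (x r).2.map Subtype.val = some v.1 ↔ (x r).2 = some v := fun r => by
    rw [← Option.map_some, (Option.map_injective Subtype.val_injective).eq_iff]
  simp only [letter, unionLabel, Φ.children_eq_empty v.2, h]
  ext y
  simp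

theorem letter_nonleaf (T : ProductTS AP S) (Φ : HierSpec AP) {v : Φ.Spec} (hv : ¬ Φ.IsLeaf v)
    (x : ∀ r : Fin n, S r × Option Φ.Leaf) (H : Set Φ.Spec) :
    letter T Φ v x H = Sum.inr '' {w ∈ Φ.children v | w ∈ H} := by
  have h : ∀ r, (x r).2.map Subtype.val ≠ some v := fun r hr => by
    obtain ⟨w, -, rfl⟩ := Option.map_eq_some_iff.1 hr
    exact hv w.2
  simp only [letter, h, false_and, exists_false, Set.ofPred_false, Set.image_empty, Set.empty_union]

/-- The cases of working and idle tasks merge, because the union over an empty group of robots is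
the empty label. -/
theorem IsAllocation.sat_unionLabel {Φ : HierSpec AP} {L : Fin n → Set AP}
    {γ : Φ.Leaf → PropFormula Φ.Atom} {m : Fin n → Option Φ.Leaf} (h : IsAllocation Φ L γ m)
    (v : Φ.Leaf) : (γ v).Sat (unionLabel Φ L {r | m r = some v}) := by
  rcases Set.eq_empty_or_nonempty {r | m r = some v} with he | hne
  · simpa [he, unionLabel] using h.idle_task v he
  · exact h.working v hne

/-- The word on which the specification `v` is evaluated. -/
def word (T : ProductTS AP S) (Φ : HierSpec AP) (v : Φ.Spec) (τ : StateSpecSeq Φ S) :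
    List (Set Φ.Atom) :=
  List.ofFn fun i : Fin τ.length =>
    letter T Φ v τ[i] {w | Holds T Φ w (τ.take ((i : ℕ) + 1))}

theorem holds_iff (T : ProductTS AP S) (Φ : HierSpec AP) (v : Φ.Spec) (τ : StateSpecSeq Φ S) :
    Holds T Φ v τ ↔ (Φ.formula v).GoodPrefix (word T Φ v τ) := by
  rw [Holds]
  simp only [word, letter, exists_prop, Set.mem_ofPred_eq]

theorem length_word (T : ProductTS AP S) (Φ : HierSpec AP) (v : Φ.Spec)
    (τ : StateSpecSeq Φ S) : (word T Φ v τ).length = τ.length := List.length_ofFn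

/-- Letter `i` depends only on times up to `i`, so truncating at any `t > i` leaves it unchanged. -/
theorem getElem_word_take (T : ProductTS AP S) (Φ : HierSpec AP) (v : Φ.Spec)
    (τ : StateSpecSeq Φ S) {t i : ℕ} (hi : i < (word T Φ v (τ.take t)).length)
    (hi' : i < τ.length) :
    (word T Φ v (τ.take t))[i] = letter T Φ v τ[i] {w | Holds T Φ w (τ.take (i + 1))} := by
  have : i < t := by
    rw [length_word, List.length_take] at hi
    omega
  simp [word, List.take_take, Nat.min_eq_left this]

theorem word_take_prefix (T : ProductTS AP S) (Φ : HierSpec AP) (v : Φ.Spec)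
    (τ : StateSpecSeq Φ S) (t : ℕ) : word T Φ v (τ.take t) <+: word T Φ v τ := by
  rw [List.prefix_iff_getElem]
  refine ⟨by simp [length_word], fun i hi => ?_⟩
  have hi' : i < τ.length := by
    rw [length_word, List.length_take] at hi
    omega
  rw [getElem_word_take T Φ v τ hi hi']
  simp [word]

/-- Satisfaction is preserved when a state-specification sequence is extended. -/
theorem Holds.of_take {T : ProductTS AP S} {Φ : HierSpec AP} {v : Φ.Spec}
    {τ : StateSpecSeq Φ S} {t : ℕ} (h : Holds T Φ v (τ.take t)) : Holds T Φ v τ :=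
  (holds_iff T Φ v τ).2 (((holds_iff T Φ v _).1 h).of_prefix (word_take_prefix T Φ v τ t))

/-- Along a run of the total product of the DFAs, a DFA accepts exactly when its specification
is satisfied by the sequence read so far. -/
theorem mem_accept_iff_holds {Φ : HierSpec AP} {A : Φ.Spec → SymbolicDFA Φ.Atom}
    (hA : ∀ v, (A v).Recognizes (Φ.formula v)) (T : ProductTS AP S) (τ : StateSpecSeq Φ S)
    (q : ℕ → TotalState Φ A) (N : ℕ) (hN : N ≤ τ.length) (hq : q 0 = fun v => (A v).start)
    (hleaf : ∀ (i : ℕ) (_ : i < N) (hi : i < τ.length),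
      IsAllocation Φ (fun r => T.label r (τ[i] r).1)
        (fun v => (A v.1).guard (q i v.1) (q (i + 1) v.1)) (fun r => (τ[i] r).2))
    (hnonleaf : ∀ i < N, ∀ v, ¬ Φ.IsLeaf v → ((A v).guard (q i v) (q (i + 1) v)).Sat
      (Sum.inr '' {w ∈ Φ.children v | q (i + 1) w ∈ (A w).accept}))
    (v : Φ.Spec) (t : ℕ) (ht : t ≤ N) :
    q t v ∈ (A v).accept ↔ Holds T Φ v (τ.take t) := by
  rw [holds_iff]
  refine (hA v).mem_accept_iff ?_
  have hlen : (word T Φ v (τ.take t)).length = t := by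
    rw [length_word, List.length_take, Nat.min_eq_left (ht.trans hN)]
  have key := (A v).reads_of_guard_sat (word T Φ v (τ.take t)) (fun i => q i v) fun i hi => by
    have hiN : i < N := (hlen ▸ hi).trans_le ht
    rw [getElem_word_take T Φ v τ hi (hiN.trans_le hN)]
    by_cases hv : Φ.IsLeaf v
    · rw [letter_leaf T Φ ⟨v, hv⟩]
      exact (hleaf i hiN (hiN.trans_le hN)).sat_unionLabel ⟨v, hv⟩
    · rw [letter_nonleaf T Φ hv]
      convert hnonleaf i hiN v hv using 2
      ext w
      refine and_congr_right fun hw => ?_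
      have := Φ.level_of_mem_children hw
      -- Recursion on a child, one level lower. Its time is `i + 1`, since the edge tests the
      -- child's state after the transition and the letter tests the prefix that includes time `i`.
      exact (mem_accept_iff_holds hA T τ q N hN hq hleaf hnonleaf w (i + 1) hiN).symm
  rwa [hlen, hq] at key
termination_by Φ.K - (v.1 : ℕ)
decreasing_by
  have := w.1.isLt
  omega

end HierLTL

open HierLTL in
theorem mainTheorem1 {AP : Type*} (Φ : HierSpec AP) (A : Φ.Spec → SymbolicDFA Φ.Atom)
    (hA : ∀ v, (A v).Recognizes (Φ.formula v))
    {n : ℕ} {S : Fin n → Type*} (T : ProductTS AP S)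
    (p : List (ProdState Φ A S)) (hp : IsAcceptingPath T p) :
    ∃ τ : StateSpecSeq Φ S,
      -- `τ` runs through the configuration states of `p`
      τ.map (fun x r => (x r).1) = p.map ProdState.conf ∧
      -- the pairing of robots with leaf specifications allocates the robots to the tasks
      (∀ (t : ℕ) (h : t + 1 < p.length) (hτ : t < τ.length),
        IsAllocation Φ (fun r => T.label r (p[t].conf r))
          (fun v => (A v.1).guard (p[t].dfa v.1) (p[t + 1].dfa v.1)) (fun r => (τ[t] r).2)) ∧
      -- leaf and non-leaf specifications: satisfied exactly when the DFA accepts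
      (∀ (t : ℕ) (h : t < p.length) (v : Φ.Spec),
        p[t].dfa v ∈ (A v).accept ↔ Holds T Φ v (τ.take t)) ∧
      -- the hierarchical specification is satisfied
      τ.Satisfies T := by
  have hpos : 0 < p.length := List.length_pos_of_ne_nil hp.nonempty
  have hmodel : ∀ t : ℕ, ∃ m : Fin n → Option Φ.Leaf, ∀ h : t + 1 < p.length,
      IsAllocation Φ (fun r => T.label r (p[t].conf r))
        (fun v => (A v.1).guard (p[t].dfa v.1) (p[t + 1].dfa v.1)) m := fun t => by
    by_cases h : t + 1 < p.length
    · obtain ⟨m, hm⟩ := (hp.steps t h).2.1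
      exact ⟨m, fun _ => hm⟩
    -- No transition leaves the last state, so any assignment serves there; all robots idle.
    · exact ⟨fun _ => none, fun h' => absurd h' h⟩
  choose m hm using hmodel
  let τ : StateSpecSeq Φ S := p.mapIdx fun t x r => (x.conf r, m t r)
  have hlen : τ.length = p.length := List.length_mapIdx
  have hτ : ∀ (t : ℕ) (h : t < τ.length),
      τ[t] = fun r => (p[t].conf r, m t r) := fun t h => List.getElem_mapIdx
  -- The default value only makes `q` total; it is never reached at indices inside the path.
  let q : ℕ → TotalState Φ A := fun t => (p.getD t (p.head hp.nonempty)).dfa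
  have hq : ∀ (t : ℕ) (h : t < p.length), q t = p[t].dfa := fun t h => by
    simp only [q, List.getD_eq_getElem _ _ h]
  have hacc : ∀ (t : ℕ) (h : t < p.length) (v : Φ.Spec),
      p[t].dfa v ∈ (A v).accept ↔ Holds T Φ v (τ.take t) := fun t h v => by
    rw [← hq t h]
    -- `p.length - 1` is the number of transitions, one less than the length of `τ`.
    refine mem_accept_iff_holds hA T τ q (p.length - 1) (by omega) ?_ ?_ ?_ v t (by omega)
    · rw [hq 0 hpos, ← List.head_eq_getElem hp.nonempty, hp.initial]
    · intro i hi hi'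
      rw [hq i (by omega), hq (i + 1) (by omega), hτ i hi']
      exact hm i (by omega)
    · intro i hi v hv
      rw [hq i (by omega), hq (i + 1) (by omega)]
      exact (hp.steps i (by omega)).2.2 v hv
  refine ⟨τ, ?_, fun t h ht => ?_, hacc, ?_⟩
  · refine List.ext_getElem (by simp [hlen]) fun i h₁ h₂ => ?_
    simp only [List.getElem_map, hτ]
  · rw [hτ t ht]
    exact hm t h
  · have := hp.accepting
    rw [List.getLast_eq_getElem, hacc] at this
    -- Acceptance at the last state gives satisfaction by `τ` without its final letter.
    exact this.of_take
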